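/- Let $G$ be a finite connected simple graph with at least two vertices. A total-colouring of $G$ assigns a colour to every vertex and every edge of $G$ (arbitrarily; it need not be proper). A path in a total-coloured graph is *total-rainbow* if its edges and internal vertices have pairwise distinct colours. The *total rainbow connection number* $trc(G)$ is the minimum number of colours in a total-colouring of $G$ such that any two vertices are connected by a total-rainbow path. The *strong total rainbow connection number* $strc(G)$ is the minimum number of colours in a total-colouring of $G$ such that any two vertices $u,v$ are connected by a total-rainbow $u$–$v$ geodesic, i.e. a total-rainbow $u$–$v$ path of length equal to the distance $d(u,v)$. Let $C_n$ denote the cycle with $n\ge 3$ vertices. **Theorem.** For every $n\ge 3$, $strc(C_n)=trc(C_n)$. Moreover, for $3\le n\le 12$ the values of $strc(C_n)$ are $$ \begin{array}{c|cccccccccc} n & 3 & 4 & 5 & 6 & 7 & 8 & 9 & 10 & 11 & 12\\ \hline strc(C_n) & 1 & 3 & 3 & 5 & 6 & 7 & 8 & 9 & 11 & 11 \end{array} $$ and $strc(C_n)=n$ for every $n\ge 13$. -/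

import Mathlib

namespace SimpleGraph

variable {V : Type*} (G : SimpleGraph V)

/-- A total-colouring of `G` with colours from `Fin k`: an arbitrary assignment of colours
to the vertices and the edges of `G` (not required to be proper). -/
abbrev TotalColouring (k : ℕ) : Type _ := V ⊕ G.edgeSet → Fin k

variable {G}

/-- The edges and the internal vertices of a `u`-`v` path `p`. -/
def Walk.pathElements {u v : V} (p : G.Walk u v) : Set (V ⊕ G.edgeSet) :=
  {x | (∃ w ∈ p.support, w ≠ u ∧ w ≠ v ∧ x = Sum.inl w) ∨
    (∃ e : G.edgeSet, (e : Sym2 V) ∈ p.edges ∧ x = Sum.inr e)}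

/-- A path is total-rainbow if its edges and internal vertices have pairwise distinct
colours. -/
def TotalColouring.IsTotalRainbow {k : ℕ} (c : G.TotalColouring k) {u v : V}
    (p : G.Walk u v) : Prop :=
  Set.InjOn c p.pathElements

/-- A total-colouring is total rainbow connected if any two vertices are connected by a
total-rainbow path. -/
def TotalColouring.IsTotalRainbowConnected {k : ℕ} (c : G.TotalColouring k) : Prop :=
  ∀ u v : V, ∃ p : G.Walk u v, p.IsPath ∧ c.IsTotalRainbow p

/-- A total-colouring is strongly total rainbow connected if any two vertices are connected
by a total-rainbow geodesic, that is, a total-rainbow path whose length is their distance. -/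
def TotalColouring.IsStronglyTotalRainbowConnected {k : ℕ} (c : G.TotalColouring k) : Prop :=
  ∀ u v : V, ∃ p : G.Walk u v, p.IsPath ∧ p.length = G.dist u v ∧ c.IsTotalRainbow p

variable (G)

/-- The total rainbow connection number of `G`: the minimum number of colours in a total
rainbow connected total-colouring (such a colouring exists if `G` is finite and connected). -/
noncomputable def trc : ℕ :=
  sInf {k : ℕ | ∃ c : G.TotalColouring k, c.IsTotalRainbowConnected}

/-- The strong total rainbow connection number of `G`: the minimum number of colours in a
strongly total rainbow connected total-colouring (such a colouring exists if `G` is finite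
and connected). -/
noncomputable def strc : ℕ :=
  sInf {k : ℕ | ∃ c : G.TotalColouring k, c.IsStronglyTotalRainbowConnected}

end SimpleGraph

/-! List the 2n vertices and edges of the cycle in cyclic order; the edges and internal vertices of
an arc with d edges are then 2d - 1 consecutive elements. It suffices to bound trc below and strc
above by the same number.

Lower bounds. A path contains one of the two arcs between its ends (`injOn_arc`). With fewer than n
colours an arc with more than n/2 edges is too big to be rainbow, so every arc with fewer than n/2
edges is (`injOn_short_arc`). Double counting then limits the vertices and edges of one colour
(`card_colour_class_le`), and summing over colours bounds k (`weight_le_mul`). For n = 11 and n ≥ 13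
no colour occurs three times, so k ≥ n. For even n, antipodal vertices already force k ≥ n - 1.

Upper bounds. Colouring position j by j mod n uses n colours; the smaller values come from explicit
lists checked by `decide`. -/

namespace SimpleGraph

open Fin.CommRing Finset

/-! ### Indices modulo n and the cyclic order of elements -/

section NatCast

variable {m : ℕ}

theorem cycleGraph_natCast_eq_iff {a b : ℕ} :
    ((a : ℕ) : Fin (m + 3)) = b ↔ a % (m + 3) = b % (m + 3) := by
  rw [Fin.ext_iff, Fin.val_natCast, Fin.val_natCast]

theorem cycleGraph_natCast_inj {a b : ℕ} (h : (a : Fin (m + 3)) = b) (hab : a < b + (m + 3))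
    (hba : b < a + (m + 3)) : a = b := by
  rw [cycleGraph_natCast_eq_iff] at h
  exact Nat.ModEq.eq_of_abs_lt (m := m + 3) h (by rw [abs_lt]; omega)

theorem cycleGraph_val_add_one (z : Fin (m + 3)) :
    (z + 1).val = if z.val = m + 2 then 0 else z.val + 1 := by
  rw [Fin.val_add_one]
  simp [Fin.ext_iff]

end NatCast

/-- The edge `{i, i + 1}` of a cycle with at least three vertices. -/
def cycleEdge {m : ℕ} (i : Fin (m + 3)) : (cycleGraph (m + 3)).edgeSet :=
  ⟨s(i, i + 1), by
    rw [mem_edgeSet, cycleGraph_adj (n := m + 1)]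
    right; ring⟩

/-- The vertices and edges of a cycle in cyclic order: vertices at even positions, edges at
odd positions. -/
def cycleElement (m j : ℕ) : Fin (m + 3) ⊕ (cycleGraph (m + 3)).edgeSet :=
  if j % 2 = 0 then Sum.inl ((j / 2 : ℕ) : Fin (m + 3))
  else Sum.inr (cycleEdge ((j / 2 : ℕ) : Fin (m + 3)))

variable {m : ℕ}

theorem cycleElement_two_mul (i : ℕ) :
    cycleElement m (2 * i) = Sum.inl (i : Fin (m + 3)) := by
  simp [cycleElement]

theorem cycleElement_two_mul_add_one (i : ℕ) :
    cycleElement m (2 * i + 1) = Sum.inr (cycleEdge (i : Fin (m + 3))) := by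
  have h : (2 * i + 1) / 2 = i := by omega
  simp [cycleElement, h, Nat.add_mod]

theorem cycleEdge_injective : Function.Injective (cycleEdge (m := m)) := by
  intro i j h
  have h' : s(i, i + 1) = s(j, j + 1) := congrArg Subtype.val h
  rw [Sym2.eq_iff] at h'
  rcases h' with ⟨h, -⟩ | ⟨h1, h2⟩
  · exact h
  · have h3 : ((2 : ℕ) : Fin (m + 3)) = (0 : ℕ) := by
      push_cast
      rw [h1] at h2
      linear_combination h2
    have := cycleGraph_natCast_inj h3 (by omega) (by omega)
    omega

theorem cycleElement_eq_iff {i j : ℕ} :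
    cycleElement m i = cycleElement m j ↔ i % (2 * (m + 3)) = j % (2 * (m + 3)) := by
  obtain ⟨a, rfl | rfl⟩ := Nat.even_or_odd' i <;> obtain ⟨b, rfl | rfl⟩ := Nat.even_or_odd' j <;>
    simp only [cycleElement_two_mul, cycleElement_two_mul_add_one, Sum.inl.injEq, Sum.inr.injEq,
      cycleEdge_injective.eq_iff, cycleGraph_natCast_eq_iff, reduceCtorEq, false_iff]
  · rw [Nat.mul_mod_mul_left, Nat.mul_mod_mul_left]; omega
  · intro h
    have := congrArg (· % 2) h
    simp only [Nat.mod_mul_right_mod] at this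
    omega
  · intro h
    have := congrArg (· % 2) h
    simp only [Nat.mod_mul_right_mod] at this
    omega
  · have h : ∀ x, (2 * x + 1) % (2 * (m + 3)) = 2 * (x % (m + 3)) + 1 := by
      intro x
      rw [Nat.mod_mul]
      have : (2 * x + 1) / 2 = x := by omega
      rw [this]; omega
    rw [h, h]; omega

theorem injOn_cycleElement {a b : ℕ} (h : b ≤ a + 2 * (m + 3)) :
    Set.InjOn (cycleElement m) (Set.Ioo a b) := by
  intro i hi j hj hij
  rw [cycleElement_eq_iff] at hij
  obtain ⟨hi1, hi2⟩ := hi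
  obtain ⟨hj1, hj2⟩ := hj
  exact Nat.ModEq.eq_of_abs_lt (m := 2 * (m + 3)) hij (by rw [abs_lt]; omega)

/-! ### Every path contains an arc -/

/-- Two edges of a cycle, one in each of the two arcs between `x` and `y`, separate `x`
from `y`. -/
theorem Walk.cycleEdge_mem_edges_or {x y : Fin (m + 3)} (p : (cycleGraph (m + 3)).Walk x y)
    {a b : ℕ} (ha : a < (y - x).val) (hb : (y - x).val ≤ b) (hbn : b < m + 3) :
    (cycleEdge (x + (a : Fin (m + 3))) : Sym2 (Fin (m + 3))) ∈ p.edges ∨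
      (cycleEdge (x + (b : Fin (m + 3))) : Sym2 (Fin (m + 3))) ∈ p.edges := by
  -- The walk must enter the set of vertices at offset in (a, b] from `x`, whose only boundary edges
  -- are the two in question.
  obtain ⟨d, hd, h1, h2⟩ := p.exists_boundary_dart
    {z | ¬(a < (z - x).val ∧ (z - x).val ≤ b)} (by simp) (by simp [ha, hb])
  have key : ∀ z : Fin (m + 3), ((¬(a < (z - x).val ∧ (z - x).val ≤ b)) ↔
      (a < (z + 1 - x).val ∧ (z + 1 - x).val ≤ b)) → z = x + a ∨ z = x + b := by
    intro z hz
    have h3 : z + 1 - x = (z - x) + 1 := by ring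
    rw [h3, cycleGraph_val_add_one] at hz
    have hlt := (z - x).isLt
    have h4 : z = x + ((z - x).val : ℕ) := by rw [Fin.cast_val_eq_self]; ring
    have h5 : (z - x).val = a ∨ (z - x).val = b := by
      split_ifs at hz <;> omega
    rcases h5 with h5 | h5 <;> rw [h5] at h4 <;> tauto
  have hde : d.edge ∈ p.edges := List.mem_map_of_mem hd
  have hadj := d.adj
  rw [cycleGraph_adj (n := m + 1)] at hadj
  simp only [Set.mem_ofPred_eq, not_not] at h1 h2
  rcases hadj with h | h
  · have h' : d.fst = d.snd + 1 := by rw [← h]; ring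
    have he : d.edge = cycleEdge d.snd := by
      change s(d.fst, d.snd) = s(d.snd, d.snd + 1)
      rw [h', Sym2.eq_swap]
    rw [he] at hde
    rcases key d.snd (by rw [← h']; tauto) with h6 | h6 <;> rw [h6] at hde <;> tauto
  · have h' : d.snd = d.fst + 1 := by rw [← h]; ring
    have he : d.edge = cycleEdge d.fst := by
      change s(d.fst, d.snd) = s(d.fst, d.fst + 1)
      rw [h']
    rw [he] at hde
    rcases key d.fst (by rw [← h']; tauto) with h6 | h6 <;> rw [h6] at hde <;> tauto

theorem Walk.cycleElement_mem_pathElements {x y : Fin (m + 3)}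
    (p : (cycleGraph (m + 3)).Walk x y) {s t : ℕ} (hst : t < s + (m + 3))
    (hxy : (x = s ∧ y = t) ∨ (x = t ∧ y = s))
    (hp : ∀ i, s ≤ i → i < t → (cycleEdge (i : Fin (m + 3)) : Sym2 (Fin (m + 3))) ∈ p.edges)
    {j : ℕ} (hj : j ∈ Set.Ioo (2 * s) (2 * t)) : cycleElement m j ∈ p.pathElements := by
  obtain ⟨hj1, hj2⟩ := hj
  obtain ⟨i, rfl | rfl⟩ := Nat.even_or_odd' j
  · left
    have hs : (i : Fin (m + 3)) ≠ s := fun h => by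
      have := cycleGraph_natCast_inj h (by omega) (by omega); omega
    have ht : (i : Fin (m + 3)) ≠ t := fun h => by
      have := cycleGraph_natCast_inj h (by omega) (by omega); omega
    refine ⟨i, p.fst_mem_support_of_mem_edges (hp i (by omega) (by omega)), ?_, ?_,
      cycleElement_two_mul i⟩ <;>
    rcases hxy with ⟨rfl, rfl⟩ | ⟨rfl, rfl⟩ <;> assumption
  · right
    exact ⟨_, hp i (by omega) (by omega), cycleElement_two_mul_add_one i⟩

theorem TotalColouring.IsTotalRainbowConnected.injOn_arc {k : ℕ}
    {c : (cycleGraph (m + 3)).TotalColouring k} (hc : c.IsTotalRainbowConnected) (u : ℕ) {d : ℕ}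
    (hd : 0 < d) (hdn : d < m + 3) :
    Set.InjOn (c ∘ cycleElement m) (Set.Ioo (2 * u) (2 * (u + d))) ∨
      Set.InjOn (c ∘ cycleElement m) (Set.Ioo (2 * (u + d)) (2 * (u + (m + 3)))) := by
  obtain ⟨p, -, hp⟩ := hc (u : Fin (m + 3)) ((u + d : ℕ) : Fin (m + 3))
  have hval : (((u + d : ℕ) : Fin (m + 3)) - (u : Fin (m + 3))).val = d := by
    have : ((u + d : ℕ) : Fin (m + 3)) - (u : Fin (m + 3)) = (d : ℕ) := by push_cast; ring
    rw [this, Fin.val_natCast, Nat.mod_eq_of_lt hdn]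
  have key : ∀ s t : ℕ, t < s + (m + 3) →
      (((u : ℕ) : Fin (m + 3)) = s ∧ ((u + d : ℕ) : Fin (m + 3)) = t ∨
        ((u : ℕ) : Fin (m + 3)) = t ∧ ((u + d : ℕ) : Fin (m + 3)) = s) →
      (∀ i, s ≤ i → i < t → (cycleEdge (i : Fin (m + 3)) : Sym2 (Fin (m + 3))) ∈ p.edges) →
      Set.InjOn (c ∘ cycleElement m) (Set.Ioo (2 * s) (2 * t)) := fun s t h1 h2 h3 =>
    Set.InjOn.comp hp (injOn_cycleElement (by omega))
      fun j hj => p.cycleElement_mem_pathElements h1 h2 h3 hj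
  by_cases h : ∀ i, u ≤ i → i < u + d →
      (cycleEdge (i : Fin (m + 3)) : Sym2 (Fin (m + 3))) ∈ p.edges
  · exact Or.inl (key _ _ (by omega) (Or.inl ⟨rfl, rfl⟩) h)
  -- An edge of the first arc is missed, so by separation no edge of the second can be.
  · push Not at h
    obtain ⟨i, hi1, hi2, hi3⟩ := h
    refine Or.inr (key _ _ (by omega) (Or.inr ⟨?_, rfl⟩) fun j hj1 hj2 => ?_)
    · rw [cycleGraph_natCast_eq_iff, Nat.add_mod_right]
    · have := p.cycleEdge_mem_edges_or (a := i - u) (b := j - u) (by omega) (by omega) (by omega)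
      rw [← Nat.cast_add, ← Nat.cast_add, Nat.add_sub_cancel' hi1,
        Nat.add_sub_cancel' (by omega)] at this
      exact this.resolve_left hi3

/-! ### Lower bounds on the number of colours -/

theorem card_Ioo_le_of_injOn {k a b : ℕ} {f : ℕ → Fin k} (h : Set.InjOn f (Set.Ioo a b)) :
    b - a - 1 ≤ k := by
  rw [← Finset.coe_Ioo] at h
  have := Finset.card_le_card_of_injOn (t := Finset.univ) f (fun _ _ => Finset.mem_univ _) h
  simpa using this

/-- The complementary arc has 2(n - d) - 1 ≥ n > k elements, so it cannot be rainbow. -/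
theorem TotalColouring.IsTotalRainbowConnected.injOn_short_arc {k : ℕ}
    {c : (cycleGraph (m + 3)).TotalColouring k} (hc : c.IsTotalRainbowConnected)
    (hk : k < m + 3) (u : ℕ) {d : ℕ} (hdn : 2 * d < m + 3) :
    Set.InjOn (c ∘ cycleElement m) (Set.Ioo (2 * u) (2 * (u + d))) := by
  rcases Nat.eq_zero_or_pos d with rfl | hd
  · simp
  · refine (hc.injOn_arc u hd (by omega)).resolve_right fun h => ?_
    have := card_Ioo_le_of_injOn h
    omega

theorem TotalColouring.IsTotalRainbowConnected.le_of_even {k d : ℕ}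
    {c : (cycleGraph (m + 3)).TotalColouring k} (hc : c.IsTotalRainbowConnected)
    (hd : m + 3 = 2 * d) : 2 * d - 1 ≤ k := by
  rcases hc.injOn_arc 0 (d := d) (by omega) (by omega) with h | h <;>
    have := card_Ioo_le_of_injOn h <;> omega

/-- Counting, for a fixed colour `a`, the pairs of an arc of length `d` and an element of
colour `a` among its edges and internal vertices. -/
theorem TotalColouring.card_colour_class_le {k d : ℕ}
    {c : (cycleGraph (m + 3)).TotalColouring k}
    (hd : 0 < d)
    (hc : ∀ u, Set.InjOn (c ∘ cycleElement m) (Set.Ioo (2 * u) (2 * (u + d)))) (a : Fin k) :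
    (d - 1) * #{i : Fin (m + 3) | c (Sum.inl i) = a} +
      d * #{i : Fin (m + 3) | c (Sum.inr (cycleEdge i)) = a} ≤ m + 3 := by
  set e := #{i : Fin (m + 3) | c (Sum.inl i) = a} with he
  set o := #{i : Fin (m + 3) | c (Sum.inr (cycleEdge i)) = a} with ho
  let g : ℕ → ℕ := fun j => if c (cycleElement m j) = a then 1 else 0
  have h1 : ∀ u : ℕ, ∑ j ∈ range (2 * d - 1), g (2 * u + 1 + j) ≤ 1 := by
    intro u
    rw [← Finset.card_filter, Finset.card_le_one]
    intro i hi j hj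
    simp only [mem_filter, mem_range] at hi hj
    have := hc u (x₁ := 2 * u + 1 + i) (x₂ := 2 * u + 1 + j) (by constructor <;> omega)
      (by constructor <;> omega) (hi.2.trans hj.2.symm)
    omega
  have h2 : ∑ u : Fin (m + 3), ∑ j ∈ range (2 * d - 1), g (2 * u.val + 1 + j) ≤ m + 3 := by
    refine (Finset.sum_le_sum fun u _ => h1 u.val).trans ?_
    simp
  have hodd : ∀ i, ∑ u : Fin (m + 3), g (2 * u.val + 1 + 2 * i) = o := by
    intro i
    rw [ho, Finset.card_filter, ← Equiv.sum_comp (Equiv.addRight (i : Fin (m + 3)))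
      (fun u => if c (Sum.inr (cycleEdge u)) = a then 1 else 0)]
    refine Finset.sum_congr rfl fun u _ => ?_
    have : 2 * u.val + 1 + 2 * i = 2 * (u.val + i) + 1 := by ring
    simp only [g, this, cycleElement_two_mul_add_one, Equiv.coe_addRight, Nat.cast_add,
      Fin.cast_val_eq_self]
    rfl
  have heven : ∀ i, ∑ u : Fin (m + 3), g (2 * u.val + 1 + (2 * i + 1)) = e := by
    intro i
    rw [he, Finset.card_filter, ← Equiv.sum_comp (Equiv.addRight ((i + 1 : ℕ) : Fin (m + 3)))
      (fun u => if c (Sum.inl u) = a then 1 else 0)]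
    refine Finset.sum_congr rfl fun u _ => ?_
    have : 2 * u.val + 1 + (2 * i + 1) = 2 * (u.val + (i + 1)) := by ring
    simp only [g, this, cycleElement_two_mul, Equiv.coe_addRight, Nat.cast_add,
      Fin.cast_val_eq_self]
  -- Summing over arcs first: each vertex lies inside d - 1 arcs and each edge in d of them.
  rw [Finset.sum_comm] at h2
  obtain ⟨d, rfl⟩ : ∃ d', d = d' + 1 := ⟨d - 1, by omega⟩
  have h3 : ∑ j ∈ range (2 * d + 1), ∑ u : Fin (m + 3), g (2 * u.val + 1 + j) =
      d * e + (d + 1) * o := by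
    clear h1 h2 hc hd
    induction d with
    | zero => simpa using hodd 0
    | succ d ih =>
      rw [show 2 * (d + 1) + 1 = 2 * d + 1 + 1 + 1 by ring, Finset.sum_range_succ,
        Finset.sum_range_succ, ih, heven, show 2 * d + 1 + 1 = 2 * (d + 1) by ring, hodd]
      ring
  rw [show 2 * (d + 1) - 1 = 2 * d + 1 by omega, h3] at h2
  simpa using h2

/-- A colour class bound, weighted by `α` on vertices and `β` on edges, bounds the number of
colours. -/
theorem TotalColouring.weight_le_mul {k α β γ : ℕ} (c : (cycleGraph (m + 3)).TotalColouring k)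
    (h : ∀ a, α * #{i : Fin (m + 3) | c (Sum.inl i) = a} +
      β * #{i : Fin (m + 3) | c (Sum.inr (cycleEdge i)) = a} ≤ γ) :
    (α + β) * (m + 3) ≤ k * γ := by
  have h1 : ∀ f : Fin (m + 3) → Fin k, ∑ a, #{i | f i = a} = m + 3 := by
    intro f
    rw [← Finset.card_eq_sum_card_fiberwise (fun _ _ => Finset.mem_coe.2 (Finset.mem_univ _))]
    simp
  calc (α + β) * (m + 3)
      = ∑ a, (α * #{i : Fin (m + 3) | c (Sum.inl i) = a} +
          β * #{i : Fin (m + 3) | c (Sum.inr (cycleEdge i)) = a}) := by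
        rw [Finset.sum_add_distrib, ← Finset.mul_sum, ← Finset.mul_sum,
          h1 (fun i => c (Sum.inl i)), h1 (fun i => c (Sum.inr (cycleEdge i)))]
        ring
    _ ≤ ∑ _a : Fin k, γ := Finset.sum_le_sum fun a _ => h a
    _ = k * γ := by simp


/-! ### Rainbow geodesics and upper bounds -/

theorem Walk.pathElements_reverse {V : Type*} {G : SimpleGraph V} {u v : V} (p : G.Walk u v) :
    p.reverse.pathElements = p.pathElements := by
  ext x
  simp only [pathElements, Set.mem_ofPred_eq, support_reverse, edges_reverse, List.mem_reverse]
  have : ∀ w, (w ∈ p.support ∧ w ≠ v ∧ w ≠ u ∧ x = Sum.inl w) ↔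
      (w ∈ p.support ∧ w ≠ u ∧ w ≠ v ∧ x = Sum.inl w) := by intro w; tauto
  simp only [this]

/-- One step changes the cyclic distance to `y` by at most one. This makes arcs of at most half the
cycle geodesics, and hence paths. -/
theorem Walk.min_le_length_of_cycleGraph {x y : Fin (m + 3)}
    (p : (cycleGraph (m + 3)).Walk x y) :
    min (y - x).val (m + 3 - (y - x).val) ≤ p.length := by
  induction p with
  | nil => simp
  | @cons x x' y h p ih =>
    rw [cycleGraph_adj (n := m + 1)] at h
    rw [length_cons]
    have h1 := (y - x).isLt
    have h2 := (y - x').isLt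
    rcases h with h | h
    · have h3 : y - x' = (y - x) + 1 := by rw [← h]; ring
      rw [h3, cycleGraph_val_add_one] at ih
      split_ifs at ih <;> omega
    · have h3 : y - x = (y - x') + 1 := by rw [← h]; ring
      rw [h3, cycleGraph_val_add_one]
      split_ifs <;> omega

theorem exists_cycleGraph_arc (u d : ℕ) :
    ∃ p : (cycleGraph (m + 3)).Walk (u : Fin (m + 3)) ((u + d : ℕ) : Fin (m + 3)),
      p.length = d ∧
      (∀ w ∈ p.support, ∃ i, u ≤ i ∧ i ≤ u + d ∧ w = (i : Fin (m + 3))) ∧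
      ∀ e ∈ p.edges, ∃ i, u ≤ i ∧ i < u + d ∧ e = cycleEdge (i : Fin (m + 3)) := by
  induction d with
  | zero => exact ⟨Walk.nil, rfl, by simpa using ⟨u, le_rfl, le_rfl, rfl⟩, by simp⟩
  | succ d ih =>
    obtain ⟨p, hp, hs, he⟩ := ih
    have hadj : (cycleGraph (m + 3)).Adj ((u + d : ℕ) : Fin (m + 3))
        ((u + (d + 1) : ℕ) : Fin (m + 3)) := by
      rw [cycleGraph_adj (n := m + 1)]
      right; push_cast; ring
    refine ⟨p.concat hadj, by simp [hp], ?_, ?_⟩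
    · intro w hw
      rw [Walk.support_concat, List.mem_append, List.mem_singleton] at hw
      rcases hw with hw | rfl
      · obtain ⟨i, h1, h2, h3⟩ := hs w hw
        exact ⟨i, h1, by omega, h3⟩
      · exact ⟨u + (d + 1), by omega, le_rfl, rfl⟩
    · intro e hw
      rw [Walk.edges_concat, List.concat_eq_append, List.mem_append, List.mem_singleton] at hw
      rcases hw with hw | rfl
      · obtain ⟨i, h1, h2, h3⟩ := he e hw
        exact ⟨i, h1, by omega, h3⟩
      · refine ⟨u + d, by omega, by omega, ?_⟩
        simp only [cycleEdge, ← add_assoc, Nat.cast_add, Nat.cast_one]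

theorem exists_totalRainbow_geodesic {k : ℕ} (c : (cycleGraph (m + 3)).TotalColouring k)
    {x y : Fin (m + 3)} (hd : 2 * (y - x).val ≤ m + 3)
    (hc : Set.InjOn (c ∘ cycleElement m) (Set.Ioo (2 * x.val) (2 * (x.val + (y - x).val)))) :
    ∃ p : (cycleGraph (m + 3)).Walk x y,
      p.IsPath ∧ p.length = (cycleGraph (m + 3)).dist x y ∧ c.IsTotalRainbow p := by
  obtain ⟨p, hp, hs, he⟩ := exists_cycleGraph_arc (m := m) x.val (y - x).val
  have hy : ((x.val + (y - x).val : ℕ) : Fin (m + 3)) = y := by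
    rw [Nat.cast_add, Fin.cast_val_eq_self, Fin.cast_val_eq_self]; ring
  have hx : ((x.val : ℕ) : Fin (m + 3)) = x := Fin.cast_val_eq_self x
  generalize hd' : (y - x).val = d at *
  generalize hx' : x.val = u at *
  have hsub : p.pathElements ⊆ cycleElement m '' Set.Ioo (2 * u) (2 * (u + d)) := by
    rintro z (⟨w, hw, h1, h2, rfl⟩ | ⟨e, hw, rfl⟩)
    · obtain ⟨i, h3, h4, rfl⟩ := hs w hw
      refine ⟨2 * i, ⟨?_, ?_⟩, cycleElement_two_mul i⟩
      · have : i ≠ u := by rintro rfl; exact h1 rfl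
        omega
      · have : i ≠ u + d := by rintro rfl; exact h2 rfl
        omega
    · obtain ⟨i, h3, h4, h5⟩ := he e hw
      refine ⟨2 * i + 1, ⟨by omega, by omega⟩, ?_⟩
      rw [cycleElement_two_mul_add_one, Subtype.ext h5]
  have hr : c.IsTotalRainbow p := hc.image_of_comp.mono hsub
  have hlen : p.length = (cycleGraph (m + 3)).dist (u : Fin (m + 3)) ((u + d : ℕ)) := by
    refine le_antisymm ?_ (dist_le p)
    obtain ⟨q, hq⟩ := p.reachable.exists_walk_length_eq_dist
    have := q.min_le_length_of_cycleGraph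
    have hv : (((u + d : ℕ) : Fin (m + 3)) - (u : Fin (m + 3))).val = d := by rw [hy, hx, hd']
    rw [hv] at this
    omega
  clear hs he hsub hc
  revert p
  rw [hx, hy]
  exact fun p _ hr hlen => ⟨p, p.isPath_of_length_eq_dist hlen, hlen, hr⟩

/-- A colouring of the elements of a cycle, listed in cyclic order, is strongly total rainbow
connected if one of the two arcs between any two vertices has at most half the length of the
cycle and pairwise distinct colours. -/
theorem exists_isStronglyTotalRainbowConnected {k : ℕ} (C : ℕ → Fin k)
    (hC : ∀ i j, i % (2 * (m + 3)) = j % (2 * (m + 3)) → C i = C j)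
    (h : ∀ x y : Fin (m + 3),
      (2 * (y - x).val ≤ m + 3 ∧
        Set.InjOn C (Set.Ioo (2 * x.val) (2 * (x.val + (y - x).val)))) ∨
      (2 * (x - y).val ≤ m + 3 ∧
        Set.InjOn C (Set.Ioo (2 * y.val) (2 * (y.val + (x - y).val))))) :
    ∃ c : (cycleGraph (m + 3)).TotalColouring k, c.IsStronglyTotalRainbowConnected := by
  have hfac : Function.FactorsThrough C (cycleElement m) := fun i j hij =>
    hC i j (cycleElement_eq_iff.1 hij)
  refine ⟨Function.extend (cycleElement m) C fun _ => C 0, fun x y => ?_⟩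
  have hcomp : (Function.extend (cycleElement m) C fun _ => C 0) ∘ cycleElement m = C :=
    funext fun j => hfac.extend_apply _ j
  rcases h x y with ⟨h1, h2⟩ | ⟨h1, h2⟩
  · exact exists_totalRainbow_geodesic _ h1 (by rwa [hcomp])
  · obtain ⟨p, hp, hl, hr⟩ := exists_totalRainbow_geodesic
      (Function.extend (cycleElement m) C fun _ => C 0) h1 (by rwa [hcomp])
    refine ⟨p.reverse, hp.reverse, by rw [Walk.length_reverse, hl, dist_comm], ?_⟩
    rw [TotalColouring.IsTotalRainbow, p.pathElements_reverse]
    exact hr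

/-- The list of colours `L`, repeated cyclically, gives distinct colours to the elements
strictly between the vertices `u` and `u + d` of a cycle. -/
abbrev ArcNodup (L : List ℕ) (u d : ℕ) : Prop :=
  ((List.range' (2 * u + 1) (2 * d - 1)).map fun j => L.getD (j % L.length) 0).Nodup

theorem exists_isStronglyTotalRainbowConnected_of_list {k : ℕ} (L : List ℕ)
    (hL : L.length = 2 * (m + 3)) (hk : 0 < k) (hLk : ∀ a ∈ L, a < k)
    (h : ∀ x y : Fin (m + 3),
      (2 * (y - x).val ≤ m + 3 ∧ ArcNodup L x.val (y - x).val) ∨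
      (2 * (x - y).val ≤ m + 3 ∧ ArcNodup L y.val (x - y).val)) :
    ∃ c : (cycleGraph (m + 3)).TotalColouring k, c.IsStronglyTotalRainbowConnected := by
  have hlt : ∀ j, L.getD (j % L.length) 0 < k := by
    intro j
    by_cases hj : j % L.length < L.length
    · rw [List.getD_eq_getElem _ _ hj]
      exact hLk _ (List.getElem_mem hj)
    · rw [List.getD_eq_default _ _ (not_lt.1 hj)]
      exact hk
  have key : ∀ u d, ArcNodup L u d →
      Set.InjOn (fun j => (⟨L.getD (j % L.length) 0, hlt j⟩ : Fin k))
        (Set.Ioo (2 * u) (2 * (u + d))) := by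
    intro u d hn i hi j hj hij
    refine List.inj_on_of_nodup_map hn ?_ ?_ (Fin.ext_iff.1 hij) <;>
      rw [List.mem_range'_1]
    · obtain ⟨h1, h2⟩ := hi; omega
    · obtain ⟨h1, h2⟩ := hj; omega
  refine exists_isStronglyTotalRainbowConnected _ (fun i j hij => ?_) fun x y =>
    (h x y).imp (And.imp_right (key _ _)) (And.imp_right (key _ _))
  simp only [hL, hij]

theorem exists_isStronglyTotalRainbowConnected_self (m : ℕ) :
    ∃ c : (cycleGraph (m + 3)).TotalColouring (m + 3), c.IsStronglyTotalRainbowConnected := by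
  -- Such an arc has at most n - 1 consecutive positions, hence distinct residues mod n.
  have key : ∀ u d, 2 * d ≤ m + 3 →
      Set.InjOn (fun j : ℕ => (j : Fin (m + 3))) (Set.Ioo (2 * u) (2 * (u + d))) := by
    rintro u d hd i ⟨hi1, hi2⟩ j ⟨hj1, hj2⟩ hij
    exact cycleGraph_natCast_inj hij (by omega) (by omega)
  refine exists_isStronglyTotalRainbowConnected (fun j => (j : Fin (m + 3))) (fun i j hij => ?_)
    fun x y => ?_
  · rw [cycleGraph_natCast_eq_iff]
    exact Nat.ModEq.of_mul_left 2 hij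
  · have : 2 * (y - x).val ≤ m + 3 ∨ 2 * (x - y).val ≤ m + 3 := by
      have h1 : (y - x) + (x - y) = 0 := by ring
      have h2 := congrArg Fin.val h1
      rw [Fin.val_add, Fin.val_zero] at h2
      have h3 := (y - x).isLt
      have h4 := (x - y).isLt
      obtain ⟨q, hq⟩ := Nat.dvd_of_mod_eq_zero h2
      have : q < 2 := by
        by_contra! hq2
        have := Nat.mul_le_mul_left (m + 3) hq2
        omega
      interval_cases q <;> omega
    exact this.imp (fun h => ⟨h, key _ _ h⟩) fun h => ⟨h, key _ _ h⟩

/-! ### The values of strc and trc -/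

theorem strc_eq_and_trc_eq {n f : ℕ}
    (hle : ∃ c : (cycleGraph n).TotalColouring f, c.IsStronglyTotalRainbowConnected)
    (hge : ∀ k, ∀ c : (cycleGraph n).TotalColouring k, c.IsTotalRainbowConnected → f ≤ k) :
    (cycleGraph n).strc = f ∧ (cycleGraph n).trc = f := by
  have hweak : ∀ {k} {c : (cycleGraph n).TotalColouring k},
      c.IsStronglyTotalRainbowConnected → c.IsTotalRainbowConnected := fun hc u v =>
    let ⟨p, h1, _, h2⟩ := hc u v
    ⟨p, h1, h2⟩
  constructor
  · refine IsLeast.csInf_eq ⟨hle, ?_⟩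
    rintro k ⟨c, hc⟩
    exact hge k c (hweak hc)
  · obtain ⟨c, hc⟩ := hle
    refine IsLeast.csInf_eq ⟨⟨c, hweak hc⟩, ?_⟩
    rintro k ⟨c, hc⟩
    exact hge k c hc

theorem TotalColouring.IsTotalRainbowConnected.card_colour_class_le {k d : ℕ}
    {c : (cycleGraph (m + 3)).TotalColouring k} (hc : c.IsTotalRainbowConnected)
    (hk : k < m + 3) (hd : 0 < d) (hdn : 2 * d < m + 3) (a : Fin k) :
    (d - 1) * #{i : Fin (m + 3) | c (Sum.inl i) = a} +
      d * #{i : Fin (m + 3) | c (Sum.inr (cycleEdge i)) = a} ≤ m + 3 :=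
  c.card_colour_class_le hd (fun u => hc.injOn_short_arc hk u hdn) a

/-- Three elements of one colour would contribute at least 3(d - 1) > n to the double count; so each
colour is used at most twice on 2n elements. -/
theorem TotalColouring.IsTotalRainbowConnected.le_of_three_mul_lt {k d : ℕ}
    {c : (cycleGraph (m + 3)).TotalColouring k} (hc : c.IsTotalRainbowConnected)
    (hdn : 2 * d < m + 3) (hd : m + 3 < 3 * (d - 1)) : m + 3 ≤ k := by
  by_contra! hk
  have := c.weight_le_mul (α := 1) (β := 1) (γ := 2) fun a => by
    have h1 := hc.card_colour_class_le hk (d := d) (by omega) hdn a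
    by_contra! h2
    obtain ⟨d, rfl⟩ : ∃ d', d = d' + 1 := ⟨d - 1, by omega⟩
    simp only [Nat.add_sub_cancel] at h1 hd
    nlinarith
  omega

theorem strc_trc_cycleGraph_of_le (m : ℕ) (hm : 10 ≤ m) :
    (cycleGraph (m + 3)).strc = m + 3 ∧ (cycleGraph (m + 3)).trc = m + 3 :=
  strc_eq_and_trc_eq (exists_isStronglyTotalRainbowConnected_self m) fun _ _ hc =>
    hc.le_of_three_mul_lt (d := (m + 2) / 2) (by omega) (by omega)

theorem strc_trc_cycleGraph_three : (cycleGraph 3).strc = 1 ∧ (cycleGraph 3).trc = 1 := by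
  refine strc_eq_and_trc_eq (exists_isStronglyTotalRainbowConnected_of_list (m := 0)
    [0, 0, 0, 0, 0, 0] rfl (by decide) (by decide) (by decide)) fun k c _ => ?_
  exact Fin.pos (c (Sum.inl 0))

theorem strc_trc_cycleGraph_four : (cycleGraph 4).strc = 3 ∧ (cycleGraph 4).trc = 3 :=
  strc_eq_and_trc_eq (exists_isStronglyTotalRainbowConnected_of_list (m := 1)
    [0, 0, 0, 0, 1, 2, 0, 1] rfl (by decide) (by decide) (by decide)) fun _ _ hc =>
    TotalColouring.IsTotalRainbowConnected.le_of_even (m := 1) (d := 2) hc rfl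

theorem strc_trc_cycleGraph_five : (cycleGraph 5).strc = 3 ∧ (cycleGraph 5).trc = 3 := by
  refine strc_eq_and_trc_eq (exists_isStronglyTotalRainbowConnected_of_list (m := 2)
    [0, 1, 0, 2, 0, 1, 2, 0, 1, 2] rfl (by decide) (by decide) (by decide)) fun k c hc => ?_
  by_contra! hk
  have := card_Ioo_le_of_injOn (TotalColouring.IsTotalRainbowConnected.injOn_short_arc
    (m := 2) hc (by omega) 0 (d := 2) (by omega))
  omega

theorem strc_trc_cycleGraph_six : (cycleGraph 6).strc = 5 ∧ (cycleGraph 6).trc = 5 :=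
  strc_eq_and_trc_eq (exists_isStronglyTotalRainbowConnected_of_list (m := 3)
    [0, 1, 0, 2, 0, 1, 3, 4, 0, 2, 1, 3] rfl (by decide) (by decide) (by decide)) fun _ _ hc =>
    TotalColouring.IsTotalRainbowConnected.le_of_even (m := 3) (d := 3) hc rfl

theorem strc_trc_cycleGraph_seven : (cycleGraph 7).strc = 6 ∧ (cycleGraph 7).trc = 6 := by
  refine strc_eq_and_trc_eq (exists_isStronglyTotalRainbowConnected_of_list (m := 4)
    [0, 1, 2, 3, 0, 4, 1, 2, 0, 3, 1, 4, 2, 5] rfl (by decide) (by decide) (by decide))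
    fun k c hc => ?_
  by_contra! hk
  -- Integrality sharpens 2e + 3o ≤ 7 to e + 2o ≤ 4, so 21 ≤ 4k; the raw inequality gives only k ≥
  -- 5.
  have := TotalColouring.weight_le_mul (m := 4) c (α := 1) (β := 2) (γ := 4) fun a => by
    have := TotalColouring.IsTotalRainbowConnected.card_colour_class_le (m := 4) hc (by omega)
      (d := 3) (by omega) (by omega) a
    omega
  omega

theorem strc_trc_cycleGraph_eight : (cycleGraph 8).strc = 7 ∧ (cycleGraph 8).trc = 7 :=
  strc_eq_and_trc_eq (exists_isStronglyTotalRainbowConnected_of_list (m := 5)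
    [0, 1, 2, 3, 0, 4, 1, 2, 5, 6, 0, 3, 1, 4, 2, 5]
    rfl (by decide) (by decide) (by decide)) fun _ _ hc =>
    TotalColouring.IsTotalRainbowConnected.le_of_even (m := 5) (d := 4) hc rfl

theorem strc_trc_cycleGraph_nine : (cycleGraph 9).strc = 8 ∧ (cycleGraph 9).trc = 8 := by
  refine strc_eq_and_trc_eq (exists_isStronglyTotalRainbowConnected_of_list (m := 6)
    [0, 1, 2, 3, 4, 5, 0, 6, 1, 7, 4, 2, 0, 3, 5, 6, 4, 7]
    rfl (by decide) (by decide) (by decide)) fun k c hc => ?_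
  by_contra! hk
  -- Likewise 3e + 4o ≤ 9 implies 2e + 3o ≤ 6 over the naturals, so 45 ≤ 6k; the raw inequality
  -- gives only k ≥ 7.
  have := TotalColouring.weight_le_mul (m := 6) c (α := 2) (β := 3) (γ := 6) fun a => by
    have := TotalColouring.IsTotalRainbowConnected.card_colour_class_le (m := 6) hc (by omega)
      (d := 4) (by omega) (by omega) a
    omega
  omega

theorem strc_trc_cycleGraph_ten : (cycleGraph 10).strc = 9 ∧ (cycleGraph 10).trc = 9 :=
  strc_eq_and_trc_eq (exists_isStronglyTotalRainbowConnected_of_list (m := 7)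
    [0, 1, 2, 3, 4, 5, 0, 6, 1, 7, 8, 2, 0, 3, 1, 4, 5, 6, 7, 8]
    rfl (by decide) (by decide) (by decide)) fun _ _ hc =>
    TotalColouring.IsTotalRainbowConnected.le_of_even (m := 7) (d := 5) hc rfl

theorem strc_trc_cycleGraph_eleven : (cycleGraph 11).strc = 11 ∧ (cycleGraph 11).trc = 11 :=
  strc_eq_and_trc_eq (exists_isStronglyTotalRainbowConnected_self 8) fun _ _ hc =>
    TotalColouring.IsTotalRainbowConnected.le_of_three_mul_lt (m := 8) (d := 5) hc
      (by omega) (by omega)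

theorem strc_trc_cycleGraph_twelve : (cycleGraph 12).strc = 11 ∧ (cycleGraph 12).trc = 11 :=
  strc_eq_and_trc_eq (exists_isStronglyTotalRainbowConnected_of_list (m := 9)
    [0, 1, 2, 3, 4, 5, 6, 7, 0, 8, 2, 9, 10, 1, 3, 4, 0, 5, 2, 6, 7, 8, 9, 10]
    rfl (by decide) (by decide) (by decide)) fun _ _ hc =>
    TotalColouring.IsTotalRainbowConnected.le_of_even (m := 9) (d := 6) hc rfl

end SimpleGraph

open SimpleGraph in
theorem theorem3p2 :
    (∀ n : ℕ, 3 ≤ n →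
      (SimpleGraph.cycleGraph n).strc = (SimpleGraph.cycleGraph n).trc) ∧
    (SimpleGraph.cycleGraph 3).strc = 1 ∧
    (SimpleGraph.cycleGraph 4).strc = 3 ∧
    (SimpleGraph.cycleGraph 5).strc = 3 ∧
    (SimpleGraph.cycleGraph 6).strc = 5 ∧
    (SimpleGraph.cycleGraph 7).strc = 6 ∧
    (SimpleGraph.cycleGraph 8).strc = 7 ∧
    (SimpleGraph.cycleGraph 9).strc = 8 ∧
    (SimpleGraph.cycleGraph 10).strc = 9 ∧
    (SimpleGraph.cycleGraph 11).strc = 11 ∧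
    (SimpleGraph.cycleGraph 12).strc = 11 ∧
    (∀ n : ℕ, 13 ≤ n → (SimpleGraph.cycleGraph n).strc = n) := by
  have hlarge : ∀ n, 13 ≤ n → (cycleGraph n).strc = n ∧ (cycleGraph n).trc = n := by
    intro n hn
    obtain ⟨m, rfl⟩ := Nat.exists_eq_add_of_le' (le_trans (by omega : 3 ≤ 13) hn)
    exact strc_trc_cycleGraph_of_le m (by omega)
  refine ⟨fun n hn => ?_, strc_trc_cycleGraph_three.1, strc_trc_cycleGraph_four.1,
    strc_trc_cycleGraph_five.1, strc_trc_cycleGraph_six.1, strc_trc_cycleGraph_seven.1,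
    strc_trc_cycleGraph_eight.1, strc_trc_cycleGraph_nine.1, strc_trc_cycleGraph_ten.1,
    strc_trc_cycleGraph_eleven.1, strc_trc_cycleGraph_twelve.1, fun n hn => (hlarge n hn).1⟩
  have of_values : ∀ {n f : ℕ}, (cycleGraph n).strc = f ∧ (cycleGraph n).trc = f →
      (cycleGraph n).strc = (cycleGraph n).trc := fun h => h.1.trans h.2.symm
  rcases lt_or_ge n 13 with h | h
  · interval_cases n
    exacts [of_values strc_trc_cycleGraph_three, of_values strc_trc_cycleGraph_four,
      of_values strc_trc_cycleGraph_five, of_values strc_trc_cycleGraph_six,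
      of_values strc_trc_cycleGraph_seven, of_values strc_trc_cycleGraph_eight,
      of_values strc_trc_cycleGraph_nine, of_values strc_trc_cycleGraph_ten,
      of_values strc_trc_cycleGraph_eleven, of_values strc_trc_cycleGraph_twelve]
  · exact of_values (hlarge n h)
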